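/- Let $\mathcal H=\ell^2(\mathbb Z;\mathbb C^2)$ and write $\Psi(x)={}^T[\Psi_L(x)\ \ \Psi_R(x)]$ for $\Psi\in\mathcal H$. Let $U=SC$ be the unitary operator on $\mathcal H$ with $$(S\Psi)(x)=\begin{bmatrix}\Psi_L(x+1)\\ \Psi_R(x-1)\end{bmatrix},\qquad (C\Psi)(x)=e^{i\Delta_x}\begin{bmatrix}\alpha_x&\beta_x\\-\overline{\beta_x}&\overline{\alpha_x}\end{bmatrix}\Psi(x),$$ where $\alpha_x,\beta_x\in\mathbb C$, $\alpha_x\neq0$, $|\alpha_x|^2+|\beta_x|^2=1$ and $\Delta_x\in[0,2\pi)$. Suppose that $(\alpha_x,\beta_x,\Delta_x)=(\alpha,\beta,\Delta)$ for all $x\neq0$, that $(\alpha_0,\beta_0,\Delta_0)=(\alpha_o,\beta_o,\Delta_o)$, and that $\Delta_o=\Delta$. Let $\sigma_{\rm p}(U)$ be the set of eigenvalues of $U$. Then $$\sigma_{\rm p}(U)\neq\emptyset\iff|\beta|^2>\Re(\beta\,\overline{\beta_o}).$$ In that case $U$ has exactly four distinct eigenvalues, $\sigma_{\rm p}(U)=\{e^{i\lambda_1},-e^{i\lambda_1},e^{i\lambda_3},-e^{i\lambda_3}\}$,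 where $$e^{i\lambda_1}=\frac{\left(\Re(\overline{\beta_o}\beta)-1\right)+i\sqrt{|\beta|^2-\Re(\overline{\beta_o}\beta)^2}}{\sqrt{1+|\beta|^2-2\Re(\overline{\beta_o}\beta)}}\,e^{i\Delta},\qquad e^{i\lambda_3}=\frac{\left(\Re(\overline{\beta_o}\beta)-1\right)-i\sqrt{|\beta|^2-\Re(\overline{\beta_o}\beta)^2}}{\sqrt{1+|\beta|^2-2\Re(\overline{\beta_o}\beta)}}\,e^{i\Delta}.$$ -/

import Mathlib

open scoped ComplexConjugate

noncomputable section

namespace QuantumWalk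

/-- The coin space `ℂ²`; coordinate `0` is the component `L`, coordinate `1` is the component `R`. -/
abbrev Spin : Type := EuclideanSpace ℂ (Fin 2)

/-- The Hilbert space of states `ℓ²(ℤ; ℂ²)`. -/
abbrev State : Type := lp (fun _ : ℤ => Spin) 2

theorem summable_sq_norm (Ψ : State) : Summable fun x => ‖Ψ x‖ ^ 2 := by
  have h := (memℓp_gen_iff (p := 2) (by norm_num)).1 (lp.memℓp Ψ)
  simpa using h

theorem memlp_of_summable {f : ℤ → Spin} (h : Summable fun x => ‖f x‖ ^ 2) : Memℓp f 2 := by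
  apply (memℓp_gen_iff (p := 2) (by norm_num)).2
  simpa using h

theorem norm_sq_eq_tsum (Ψ : State) : ‖Ψ‖ ^ 2 = ∑' x, ‖Ψ x‖ ^ 2 := by
  have h := lp.norm_rpow_eq_tsum (p := 2) (by norm_num) Ψ
  simpa using h

theorem spin_norm_sq (v : Spin) : ‖v‖ ^ 2 = ‖v 0‖ ^ 2 + ‖v 1‖ ^ 2 := by
  rw [EuclideanSpace.norm_sq_eq, Fin.sum_univ_two]

theorem summable_component (Ψ : State) (j : Fin 2) : Summable fun x => ‖Ψ x j‖ ^ 2 := by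
  refine Summable.of_nonneg_of_le (fun x => by positivity) (fun x => ?_) (summable_sq_norm Ψ)
  have h := PiLp.norm_apply_le (Ψ x) j
  gcongr

theorem summable_component_shift (Ψ : State) (j : Fin 2) (k : ℤ) :
    Summable fun x => ‖Ψ (x + k) j‖ ^ 2 :=
  (Equiv.addRight k).summable_iff.2 (summable_component Ψ j)

/-- The map `(Ψ_L(x), Ψ_R(x)) ↦ (Ψ_L(x + k), Ψ_R(x + l))` on states. -/
def translate (k l : ℤ) : State →ₗ[ℂ] State where
  toFun Ψ := ⟨fun x => !₂[Ψ (x + k) 0, Ψ (x + l) 1], memlp_of_summable (by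
    simpa [spin_norm_sq] using
      (summable_component_shift Ψ 0 k).add (summable_component_shift Ψ 1 l))⟩
  map_add' Φ Ψ := by
    ext x j
    fin_cases j <;> rfl
  map_smul' c Ψ := by
    ext x j
    fin_cases j <;> rfl

theorem translate_apply (k l : ℤ) (Ψ : State) (x : ℤ) :
    translate k l Ψ x = !₂[Ψ (x + k) 0, Ψ (x + l) 1] := rfl

theorem norm_translate (k l : ℤ) (Ψ : State) : ‖translate k l Ψ‖ = ‖Ψ‖ := by
  have e (j : Fin 2) (k : ℤ) : ∑' x, ‖Ψ (x + k) j‖ ^ 2 = ∑' x, ‖Ψ x j‖ ^ 2 :=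
    (Equiv.addRight k).tsum_eq fun x => ‖Ψ x j‖ ^ 2
  have h : ‖translate k l Ψ‖ ^ 2 = ‖Ψ‖ ^ 2 := by
    rw [norm_sq_eq_tsum, norm_sq_eq_tsum]
    simp only [spin_norm_sq, translate_apply]
    rw [(summable_component Ψ 0).tsum_add (summable_component Ψ 1), ← e 0 k, ← e 1 l]
    exact (summable_component_shift Ψ 0 k).tsum_add (summable_component_shift Ψ 1 l)
  exact (sq_eq_sq₀ (norm_nonneg _) (norm_nonneg _)).1 h

/-- The shift operator, `(S Ψ)(x) = (Ψ_L(x + 1), Ψ_R(x - 1))`, a unitary operator. -/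
def shift : State ≃ₗᵢ[ℂ] State where
  toLinearEquiv := LinearEquiv.ofLinearMap (translate 1 (-1)) (translate (-1) 1)
    (by ext Ψ x j; fin_cases j <;> simp [translate_apply])
    (by ext Ψ x j; fin_cases j <;> simp [translate_apply])
  norm_map' Ψ := norm_translate 1 (-1) Ψ

/-- Parameters `(α, β, Δ)` of a coin matrix. -/
structure CoinParams where
  /-- The diagonal parameter. -/
  α : ℂ
  /-- The off-diagonal parameter. -/
  β : ℂ
  /-- The phase. -/
  Δ : ℝ
  α_ne_zero : α ≠ 0
  norm_sq_add : ‖α‖ ^ 2 + ‖β‖ ^ 2 = 1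
  Δ_mem : Δ ∈ Set.Ico 0 (2 * Real.pi)

namespace CoinParams

/-- The coin matrix `e^{iΔ} [[α, β], [-conj β, conj α]]`. -/
def coinMatrix (c : CoinParams) : Matrix (Fin 2) (Fin 2) ℂ :=
  Complex.exp (Complex.I * c.Δ) • !![c.α, c.β; -conj c.β, conj c.α]

theorem coinMatrix_mem (c : CoinParams) : c.coinMatrix ∈ Matrix.unitaryGroup (Fin 2) ℂ := by
  have h1 : c.α * conj c.α + c.β * conj c.β = 1 := by
    rw [Complex.mul_conj', Complex.mul_conj']
    exact_mod_cast c.norm_sq_add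
  have h2 : Complex.exp (Complex.I * c.Δ) * conj (Complex.exp (Complex.I * c.Δ)) = 1 := by
    rw [Complex.mul_conj', mul_comm, Complex.norm_exp_ofReal_mul_I]
    simp
  rw [Matrix.mem_unitaryGroup_iff]
  have h3 : !![c.α, c.β; -conj c.β, conj c.α] * star !![c.α, c.β; -conj c.β, conj c.α]
      = (1 : Matrix (Fin 2) (Fin 2) ℂ) := by
    ext i j
    fin_cases i <;> fin_cases j <;> simp [Matrix.mul_apply, Fin.sum_univ_two, Matrix.star_apply]
    · linear_combination h1
    · ring
    · ring
    · linear_combination h1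
  rw [coinMatrix, star_smul, smul_mul_smul_comm, h3]
  erw [h2]
  rw [one_smul]

/-- The coin matrix as an element of the unitary group. -/
def coin (c : CoinParams) : Matrix.unitaryGroup (Fin 2) ℂ := ⟨c.coinMatrix, c.coinMatrix_mem⟩

end CoinParams

/-- A unitary matrix acting on `ℂ²` by matrix-vector multiplication. -/
def spinAct (A : Matrix.unitaryGroup (Fin 2) ℂ) (v : Spin) : Spin :=
  WithLp.toLp 2 ((A : Matrix (Fin 2) (Fin 2) ℂ).mulVec v.ofLp)

theorem norm_spinAct (A : Matrix.unitaryGroup (Fin 2) ℂ) (v : Spin) : ‖spinAct A v‖ = ‖v‖ := by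
  have h : inner ℂ (spinAct A v) (spinAct A v) = inner ℂ v v := by
    have hA := Matrix.mem_unitaryGroup_iff'.1 A.2
    rw [Matrix.star_eq_conjTranspose] at hA
    simp only [EuclideanSpace.inner_eq_star_dotProduct, spinAct]
    rw [Matrix.star_mulVec, dotProduct_comm, ← Matrix.dotProduct_mulVec, Matrix.mulVec_mulVec, hA,
      Matrix.one_mulVec, dotProduct_comm]
  rw [inner_self_eq_norm_sq_to_K, inner_self_eq_norm_sq_to_K] at h
  exact (sq_eq_sq₀ (norm_nonneg _) (norm_nonneg _)).1 (by exact_mod_cast h)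

theorem spinAct_mul (A B : Matrix.unitaryGroup (Fin 2) ℂ) (v : Spin) :
    spinAct A (spinAct B v) = spinAct (A * B) v := by
  simp only [spinAct, Matrix.mulVec_mulVec, Submonoid.coe_mul]

theorem spinAct_one (v : Spin) : spinAct 1 v = v := by
  simp [spinAct]

/-- The operator `(C Ψ)(x) = A_x Ψ(x)` for a family of unitary matrices, as a linear map. -/
def coinMap (A : ℤ → Matrix.unitaryGroup (Fin 2) ℂ) : State →ₗ[ℂ] State where
  toFun Ψ := ⟨fun x => spinAct (A x) (Ψ x), memlp_of_summable (by
    simpa only [norm_spinAct] using summable_sq_norm Ψ)⟩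
  map_add' Φ Ψ := by
    ext x j
    exact congrFun (Matrix.mulVec_add _ (Φ x).ofLp (Ψ x).ofLp) j
  map_smul' c Ψ := by
    ext x j
    exact congrFun (Matrix.mulVec_smul _ c (Ψ x).ofLp) j

theorem coinMap_apply (A : ℤ → Matrix.unitaryGroup (Fin 2) ℂ) (Ψ : State) (x : ℤ) :
    coinMap A Ψ x = spinAct (A x) (Ψ x) := rfl

/-- The coin operator, `(C Ψ)(x) = A_x Ψ(x)`, a unitary operator. -/
def coinOperator (A : ℤ → Matrix.unitaryGroup (Fin 2) ℂ) : State ≃ₗᵢ[ℂ] State where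
  toLinearEquiv := LinearEquiv.ofLinearMap (coinMap A) (coinMap fun x => (A x)⁻¹)
    (by ext Ψ x j; simp [coinMap_apply, spinAct_mul, spinAct_one])
    (by ext Ψ x j; simp [coinMap_apply, spinAct_mul, spinAct_one])
  norm_map' Ψ := by
    have h : ‖coinMap A Ψ‖ ^ 2 = ‖Ψ‖ ^ 2 := by
      rw [norm_sq_eq_tsum, norm_sq_eq_tsum]
      simp only [coinMap_apply, norm_spinAct]
    exact (sq_eq_sq₀ (norm_nonneg _) (norm_nonneg _)).1 h

/-- The time evolution `U = S C` of the walk whose coin at position `x` has parameters `c x`. -/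
def timeEvolution (c : ℤ → CoinParams) : State ≃ₗᵢ[ℂ] State :=
  (coinOperator fun x => (c x).coin).trans shift

/-- The coin parameters of a two-phase walk with one defect: `m` on the negative half-line, `o` at
the origin, `p` on the positive half-line. -/
def twoPhaseOneDefect (m o p : CoinParams) (x : ℤ) : CoinParams :=
  if x < 0 then m else if x = 0 then o else p

/-- The point spectrum (the set of eigenvalues) of an operator on the space of states. -/
def pointSpectrum (U : State ≃ₗᵢ[ℂ] State) : Set ℂ :=
  {z | Module.End.HasEigenvalue (U.toLinearEquiv : State →ₗ[ℂ] State) z}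

end QuantumWalk

end

/-!
Write an eigenvalue as `z = e^{iΔ} μ` with `|μ| = 1` and `μ = c + i s`. In terms of the vectors
`v(x) = (Ψ_L(x - 1), Ψ_R(x))` the eigenvalue equation becomes a first-order recursion
`α_x v(x + 1) = (c + N_x) v(x)` (`mem_pointSpectrum_iff_transfer`), where
`N_x = [[i s, -β_x], [-conj β_x, -i s]]` is trace-free, so that `N² = |β|² - s²` away from the
origin.

Along a half-line without defect, `det (v, N v)` has constant modulus. For a square-summable
solution it tends to zero, hence vanishes, and `v` is an eigenvector of `N`, with a contracting
multiplier (`exists_isTraceFreeEigen_of_tendsto`). The left half-line is covered by the same lemma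
through `Transfer.symm`. The product `(c + k) (c - k) = |α|²` of the multipliers shows that the two
half-lines carry opposite eigenvalues `k` (left) and `-k` (right) of `N`.

Since `N N₀ + N₀ N = 2 (r - s²)` with `r = Re (conj βₒ β)`, the defect maps the `k`-eigenvector into
the `-k`-eigenspace exactly when `c k = s² - r` (`isTraceFreeEigen_neg_iff`). Squaring, with
`c² = 1 - s²` and `k² = |β|² - s²`, gives `s² (1 + |β|² - 2 r) = |β|² - r²`; the sign `c k > 0`
coming from decay means `s² > r`, hence `|β|² > r`. Both steps can be reversed
(`mem_pointSpectrum_iff_im_sq`), and solving for `c` and `s` yields the four eigenvalues.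
-/

open Complex Filter Topology

namespace QuantumWalk

/-! ### Decaying solutions on a half-line -/

/-- The transfer relation at one site, with the hopping amplitude `α` cleared: the vector `(P, Q)`
on the left of the site and the vector `(P', Q')` on its right satisfy
`α (P', Q') = [[μ, -β], [-conj β, conj μ]] (P, Q)`. -/
def Transfer (α β μ P Q P' Q' : ℂ) : Prop :=
  α * P' = μ * P - β * Q ∧ α * Q' = -conj β * P + conj μ * Q

/-- The vector `(P, Q)` is in the kernel of `N - k`, where `N = [[i Im μ, -β], [-conj β, -i Im μ]]`
is the trace-free part of the transfer matrix. -/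
def IsTraceFreeEigen (β μ k P Q : ℂ) : Prop :=
  I * μ.im * P - β * Q = k * P ∧ -conj β * P - I * μ.im * Q = k * Q

theorem re_add_I_mul_im (μ : ℂ) : (μ.re : ℂ) + I * μ.im = μ := by
  rw [mul_comm]; exact re_add_im μ

theorem re_sub_I_mul_im (μ : ℂ) : (μ.re : ℂ) - I * μ.im = conj μ := by
  apply Complex.ext <;> simp

theorem re_sq_add_im_sq {μ : ℂ} (hμ : ‖μ‖ = 1) : μ.re ^ 2 + μ.im ^ 2 = 1 := by
  have h := Complex.sq_norm μ
  rw [hμ, normSq_apply] at h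
  linarith

theorem mul_conj_of_norm_one {μ : ℂ} (hμ : ‖μ‖ = 1) : μ * conj μ = 1 := by
  rw [mul_conj', hμ]; norm_num

/-- Inverting a transfer relation gives a transfer relation for the conjugate parameters, so that
the left half-line need not be treated separately. -/
theorem Transfer.symm {α β μ P Q P' Q' : ℂ} (hα : α ≠ 0) (hαβ : ‖α‖ ^ 2 + ‖β‖ ^ 2 = 1)
    (hμ : ‖μ‖ = 1) (h : Transfer α β μ P Q P' Q') :
    Transfer (conj α) (-β) (conj μ) P' Q' P Q := by
  have h1 : α * conj α + β * conj β = 1 := by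
    rw [mul_conj', mul_conj']; exact_mod_cast hαβ
  have h2 := mul_conj_of_norm_one hμ
  obtain ⟨e1, e2⟩ := h
  constructor
  · apply mul_left_cancel₀ hα
    linear_combination P * h1 - conj μ * e1 - β * e2 - P * h2
  · apply mul_left_cancel₀ hα
    simp only [map_neg, conj_conj]
    linear_combination Q * h1 - conj β * e1 - μ * e2 - Q * h2

theorem Transfer.eq_zero {α β μ P Q P' Q' : ℂ} (hα : α ≠ 0) (h : Transfer α β μ P Q P' Q')
    (hP : P = 0) (hQ : Q = 0) : P' = 0 ∧ Q' = 0 := by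
  obtain ⟨e1, e2⟩ := h
  subst hP hQ
  simpa [hα] using And.intro e1 e2

theorem IsTraceFreeEigen.sq_eq {β μ k P Q : ℂ} (h : IsTraceFreeEigen β μ k P Q)
    (h0 : ¬(P = 0 ∧ Q = 0)) : k ^ 2 = ((‖β‖ ^ 2 - μ.im ^ 2 : ℝ) : ℂ) := by
  obtain ⟨e1, e2⟩ := h
  have hb : β * conj β = (‖β‖ : ℂ) ^ 2 := mul_conj' β
  push_cast
  by_cases hP : P = 0
  · have hQ : Q ≠ 0 := fun hQ => h0 ⟨hP, hQ⟩
    apply mul_right_cancel₀ hQ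
    linear_combination (-k + I * μ.im) * e2 + conj β * e1 + Q * hb + (μ.im : ℂ) ^ 2 * Q * I_sq
  · apply mul_right_cancel₀ hP
    linear_combination (-k - I * μ.im) * e1 + β * e2 + P * hb + (μ.im : ℂ) ^ 2 * P * I_sq

/-- A nonzero decaying solution on a half-line starts in an eigenvector of the trace-free part `N`,
with a contracting multiplier. The reason is that `det (v, N v)` has constant modulus along the
solution, so that decay forces it to vanish. -/
theorem exists_isTraceFreeEigen_of_tendsto {α β μ : ℂ} (hα : α ≠ 0)
    (hαβ : ‖α‖ ^ 2 + ‖β‖ ^ 2 = 1) (hμ : ‖μ‖ = 1) {P Q : ℕ → ℂ}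
    (h : ∀ n, Transfer α β μ (P n) (Q n) (P (n + 1)) (Q (n + 1)))
    (hP : Tendsto P atTop (𝓝 0)) (hQ : Tendsto Q atTop (𝓝 0)) (h0 : ¬(P 0 = 0 ∧ Q 0 = 0)) :
    ∃ k, IsTraceFreeEigen β μ k (P 0) (Q 0) ∧ ‖μ.re + k‖ < ‖α‖ := by
  have h1 : α * conj α + β * conj β = 1 := by
    rw [mul_conj', mul_conj']; exact_mod_cast hαβ
  have h2 := mul_conj_of_norm_one hμ
  have hre := re_add_I_mul_im μ
  have hre' := re_sub_I_mul_im μ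
  let D : ℕ → ℂ := fun n => -conj β * P n ^ 2 - 2 * I * μ.im * P n * Q n + β * Q n ^ 2
  have hD : ∀ n, ‖D n‖ = ‖D 0‖ := by
    intro n
    induction n with
    | zero => rfl
    | succ n ih =>
      rw [← ih]
      obtain ⟨e1, e2⟩ := h n
      have e : α ^ 2 * D (n + 1) = (α * conj α) * D n := by
        have : α ^ 2 * D (n + 1) = -conj β * (α * P (n + 1)) ^ 2
            - 2 * I * μ.im * (α * P (n + 1)) * (α * Q (n + 1)) + β * (α * Q (n + 1)) ^ 2 := by
          simp only [D]; ring
        have hs : 2 * I * μ.im = μ - conj μ := by linear_combination hre - hre'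
        have hα' : α * conj α = μ * conj μ - β * conj β := by linear_combination h1 - h2
        rw [this, e1, e2, hα']
        simp only [D, hs]
        ring
      have e' := congrArg norm e
      rw [norm_mul, norm_mul, norm_mul, norm_pow, norm_conj, ← sq] at e'
      exact mul_left_cancel₀ (pow_ne_zero 2 (norm_ne_zero_iff.2 hα)) e'
  have hD0 : D 0 = 0 := by
    have t : Tendsto (fun n => ‖D n‖) atTop (𝓝 0) := by
      have := (((hP.pow 2).const_mul (-conj β)).sub
        ((hP.const_mul (2 * I * μ.im)).mul hQ)).add ((hQ.pow 2).const_mul β)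
      simpa [D] using this.norm
    simp only [hD] at t
    exact norm_eq_zero.1 (tendsto_nhds_unique tendsto_const_nhds t)
  have hk : ∃ k, IsTraceFreeEigen β μ k (P 0) (Q 0) := by
    by_cases hP0 : P 0 = 0
    · have hQ0 : Q 0 ≠ 0 := fun hQ0 => h0 ⟨hP0, hQ0⟩
      have hβ : β = 0 := by simpa [D, hP0, hQ0] using hD0
      exact ⟨-(I * μ.im), by simp [hβ, hP0], by simp [hβ]⟩
    · refine ⟨I * μ.im - β * Q 0 / P 0, ?_, ?_⟩
      · field_simp
      · field_simp
        linear_combination hD0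
  obtain ⟨k, hk⟩ := hk
  refine ⟨k, hk, ?_⟩
  have hζ : α * ((μ.re + k) / α) = μ.re + k := mul_div_cancel₀ _ hα
  have hgeo : ∀ n, P n = ((μ.re + k) / α) ^ n * P 0 ∧ Q n = ((μ.re + k) / α) ^ n * Q 0 := by
    intro n
    induction n with
    | zero => simp
    | succ n ih =>
      obtain ⟨e1, e2⟩ := h n
      obtain ⟨k1, k2⟩ := hk
      rw [ih.1, ih.2] at e1 e2
      constructor
      · apply mul_left_cancel₀ hα
        rw [e1, pow_succ]
        linear_combination ((μ.re + k) / α) ^ n * (-P 0 * hre + k1 - P 0 * hζ)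
      · apply mul_left_cancel₀ hα
        rw [e2, pow_succ]
        linear_combination ((μ.re + k) / α) ^ n * (-Q 0 * hre' + k2 - Q 0 * hζ)
  by_contra hlt
  have hge : 1 ≤ ‖(μ.re + k) / α‖ := by
    rw [norm_div, one_le_div (norm_pos_iff.2 hα)]
    exact not_lt.1 hlt
  have key : ∀ R : ℕ → ℂ, (∀ n, R n = ((μ.re + k) / α) ^ n * R 0) → Tendsto R atTop (𝓝 0) →
      R 0 = 0 := by
    intro R hR t
    have hb : ∀ n, ‖R 0‖ ≤ ‖R n‖ := fun n => by
      rw [hR n, norm_mul, norm_pow]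
      exact le_mul_of_one_le_left (norm_nonneg _) (one_le_pow₀ hge)
    have := ge_of_tendsto' t.norm hb
    simpa using this
  exact h0 ⟨key P (fun n => (hgeo n).1) hP, key Q (fun n => (hgeo n).2) hQ⟩

/-! ### Matching the two half-lines at the defect -/

/-- Matching at the defect: because `N N₀ + N₀ N` is the scalar `2 (Re (conj βₒ β) - (Im μ)²)`, the
defect transfer matrix maps the `k`-eigenvector of `N` on its left into the `-k`-eigenspace exactly
when `k Re μ + (Re (conj βₒ β) - (Im μ)²)` vanishes. -/
theorem isTraceFreeEigen_neg_iff {α₀ β β₀ μ k P Q P' Q' : ℂ} (hα₀ : α₀ ≠ 0)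
    (h : Transfer α₀ β₀ μ P Q P' Q') (hk : IsTraceFreeEigen β μ k P Q) (h0 : ¬(P = 0 ∧ Q = 0)) :
    IsTraceFreeEigen β μ (-k) P' Q' ↔
      μ.re * k = ((μ.im ^ 2 - (conj β₀ * β).re : ℝ) : ℂ) := by
  obtain ⟨e1, e2⟩ := h
  obtain ⟨k1, k2⟩ := hk
  have hr : 2 * ((conj β₀ * β).re : ℂ) = conj β₀ * β + β₀ * conj β := by
    have := add_conj (conj β₀ * β)
    simp only [map_mul, conj_conj] at this
    rw [this]; push_cast; ring
  have hre := re_add_I_mul_im μ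
  have hre' := re_sub_I_mul_im μ
  unfold IsTraceFreeEigen
  push_cast
  generalize ((conj β₀ * β).re : ℂ) = r at hr ⊢
  generalize (μ.re : ℂ) = c at hre hre' ⊢
  generalize (μ.im : ℂ) = s at k1 k2 hre hre' ⊢
  have f1 : α₀ * (I * s * P' - β * Q' - -k * P') = 2 * (c * k - (s ^ 2 - r)) * P := by
    linear_combination (I * s + k) * e1 - β * e2 + (c - I * s) * k1 + β₀ * k2
      - (I * s + k) * P * hre + β * Q * hre' - P * hr + 2 * s ^ 2 * P * I_sq
  have f2 : α₀ * (-conj β * P' - I * s * Q' - -k * Q') = 2 * (c * k - (s ^ 2 - r)) * Q := by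
    linear_combination -conj β * e1 + (k - I * s) * e2 + (c + I * s) * k2 + conj β₀ * k1
      + conj β * P * hre - (k - I * s) * Q * hre' - Q * hr + 2 * s ^ 2 * Q * I_sq
  constructor
  · rintro ⟨g1, g2⟩
    rw [g1, sub_self, mul_zero] at f1
    rw [g2, sub_self, mul_zero] at f2
    by_contra hne
    have hne' : 2 * (c * k - (s ^ 2 - r)) ≠ 0 := mul_ne_zero two_ne_zero (sub_ne_zero.2 hne)
    exact h0 ⟨(mul_eq_zero.1 f1.symm).resolve_left hne', (mul_eq_zero.1 f2.symm).resolve_left hne'⟩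
  · intro g
    rw [g, sub_self, mul_zero, zero_mul] at f1 f2
    exact ⟨sub_eq_zero.1 ((mul_eq_zero.1 f1).resolve_left hα₀),
      sub_eq_zero.1 ((mul_eq_zero.1 f2).resolve_left hα₀)⟩

/-! ### Reduction of the eigenvalue equation to transfer relations -/

theorem coin_eq_iff_transfer {α β μ P Q P' Q' : ℂ} (hα : α ≠ 0) (hαβ : ‖α‖ ^ 2 + ‖β‖ ^ 2 = 1)
    (hμ : ‖μ‖ = 1) :
    (α * P' + β * Q = μ * P ∧ -conj β * P' + conj α * Q = μ * Q') ↔ Transfer α β μ P Q P' Q' := by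
  have h1 : α * conj α + β * conj β = 1 := by
    rw [mul_conj', mul_conj']; exact_mod_cast hαβ
  have h2 := mul_conj_of_norm_one hμ
  have hμ0 : μ ≠ 0 := by rintro rfl; simp at hμ
  constructor
  · rintro ⟨e1, e2⟩
    refine ⟨by linear_combination e1, ?_⟩
    apply mul_left_cancel₀ hμ0
    linear_combination -α * e2 - conj β * e1 + Q * h1 - Q * h2
  · rintro ⟨e1, e2⟩
    refine ⟨by linear_combination e1, ?_⟩
    apply mul_left_cancel₀ hα
    linear_combination -conj β * e1 - μ * e2 + Q * h1 - Q * h2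

theorem timeEvolution_apply_zero (c : ℤ → CoinParams) (Ψ : State) (x : ℤ) :
    timeEvolution c Ψ x 0 = exp (I * (c (x + 1)).Δ) *
      ((c (x + 1)).α * Ψ (x + 1) 0 + (c (x + 1)).β * Ψ (x + 1) 1) := by
  have : timeEvolution c Ψ x 0 =
      ((c (x + 1)).coinMatrix.mulVec (Ψ (x + 1)).ofLp) 0 := rfl
  rw [this]
  simp [CoinParams.coinMatrix, Matrix.mulVec, dotProduct, Fin.sum_univ_two]
  ring

theorem timeEvolution_apply_one (c : ℤ → CoinParams) (Ψ : State) (x : ℤ) :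
    timeEvolution c Ψ x 1 = exp (I * (c (x - 1)).Δ) *
      (-conj (c (x - 1)).β * Ψ (x - 1) 0 + conj (c (x - 1)).α * Ψ (x - 1) 1) := by
  have : timeEvolution c Ψ x 1 =
      ((c (x - 1)).coinMatrix.mulVec (Ψ (x - 1)).ofLp) 1 := rfl
  rw [this]
  simp [CoinParams.coinMatrix, Matrix.mulVec, dotProduct, Fin.sum_univ_two]
  ring

theorem mem_pointSpectrum_iff_exists (U : State ≃ₗᵢ[ℂ] State) (z : ℂ) :
    z ∈ pointSpectrum U ↔ ∃ Ψ : State, Ψ ≠ 0 ∧ U Ψ = z • Ψ := by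
  constructor
  · intro h
    obtain ⟨Ψ, hΨ⟩ := Module.End.HasEigenvalue.exists_hasEigenvector h
    exact ⟨Ψ, hΨ.2, hΨ.apply_eq_smul⟩
  · rintro ⟨Ψ, h0, h⟩
    exact Module.End.hasEigenvalue_of_hasEigenvector
      (Module.End.hasEigenvector_iff.2 ⟨Module.End.mem_eigenspace_iff.2 h, h0⟩)

theorem norm_eq_one_of_mem_pointSpectrum {U : State ≃ₗᵢ[ℂ] State} {z : ℂ}
    (hz : z ∈ pointSpectrum U) : ‖z‖ = 1 := by
  obtain ⟨Ψ, h0, h⟩ := (mem_pointSpectrum_iff_exists U z).1 hz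
  have e := U.norm_map Ψ
  rw [h, norm_smul] at e
  exact (mul_eq_right₀ (norm_ne_zero_iff.2 h0)).1 e

/-- With `P x = Ψ_L (x - 1)` and `Q x = Ψ_R x`, the eigenvalue equation for `e^{iΔ} μ` says that
`(P, Q)` satisfies the transfer relation of every site. -/
theorem mem_pointSpectrum_iff_transfer (c : ℤ → CoinParams) {Δ : ℝ} (hΔ : ∀ x, (c x).Δ = Δ)
    {μ : ℂ} (hμ : ‖μ‖ = 1) :
    exp (I * Δ) * μ ∈ pointSpectrum (timeEvolution c) ↔
      ∃ P Q : ℤ → ℂ, (Summable fun x => ‖P x‖ ^ 2) ∧ (Summable fun x => ‖Q x‖ ^ 2) ∧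
        (∃ x, ¬(P x = 0 ∧ Q x = 0)) ∧
        ∀ x, Transfer (c x).α (c x).β μ (P x) (Q x) (P (x + 1)) (Q (x + 1)) := by
  rw [mem_pointSpectrum_iff_exists]
  constructor
  · rintro ⟨Ψ, h0, h⟩
    refine ⟨fun x => Ψ (x - 1) 0, fun x => Ψ x 1, summable_component_shift Ψ 0 (-1),
      summable_component Ψ 1, ?_, fun x => ?_⟩
    · by_contra! hall
      apply h0
      ext x j
      fin_cases j
      · simpa using (hall (x + 1)).1
      · simpa using (hall x).2
    · rw [← coin_eq_iff_transfer (c x).α_ne_zero (c x).norm_sq_add hμ]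
      have e0 : timeEvolution c Ψ (x - 1) 0 = exp (I * Δ) * μ * Ψ (x - 1) 0 := by rw [h]; rfl
      have e1 : timeEvolution c Ψ (x + 1) 1 = exp (I * Δ) * μ * Ψ (x + 1) 1 := by rw [h]; rfl
      rw [timeEvolution_apply_zero, sub_add_cancel, hΔ, mul_assoc] at e0
      rw [timeEvolution_apply_one, add_sub_cancel_right, hΔ, mul_assoc] at e1
      simp only [add_sub_cancel_right]
      exact ⟨mul_left_cancel₀ (exp_ne_zero _) e0, mul_left_cancel₀ (exp_ne_zero _) e1⟩
  · rintro ⟨P, Q, hP, hQ, ⟨y, hy⟩, h⟩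
    have hsum : Summable fun x : ℤ => ‖(!₂[P (x + 1), Q x] : Spin)‖ ^ 2 := by
      simpa [spin_norm_sq] using ((Equiv.addRight (1 : ℤ)).summable_iff.2 hP).add hQ
    refine ⟨⟨fun x => !₂[P (x + 1), Q x], memlp_of_summable hsum⟩, ?_, ?_⟩
    · intro hzero
      apply hy
      constructor
      · have := congrArg (fun Φ : State => Φ (y - 1) 0) hzero
        simpa using this
      · have := congrArg (fun Φ : State => Φ y 1) hzero
        simpa using this
    · ext x j
      fin_cases j
      · have e := ((coin_eq_iff_transfer (c (x + 1)).α_ne_zero (c (x + 1)).norm_sq_add hμ).2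
          (h (x + 1))).1
        refine (timeEvolution_apply_zero c _ x).trans ?_
        rw [hΔ]
        refine (congrArg (exp (I * Δ) * ·) e).trans ?_
        exact (mul_assoc _ _ _).symm
      · have e := ((coin_eq_iff_transfer (c (x - 1)).α_ne_zero (c (x - 1)).norm_sq_add hμ).2
          (h (x - 1))).2
        rw [sub_add_cancel] at e
        refine (timeEvolution_apply_one c _ x).trans ?_
        rw [hΔ]
        simp only [Matrix.cons_val_zero, Matrix.cons_val_one, sub_add_cancel]
        refine (congrArg (exp (I * Δ) * ·) e).trans ?_
        exact (mul_assoc _ _ _).symm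

/-! ### Eigenvalues of the walk with one defect -/

theorem tendsto_zero_of_summable_norm_sq {P : ℤ → ℂ} (hP : Summable fun x => ‖P x‖ ^ 2)
    {f : ℕ → ℤ} (hf : Function.Injective f) : Tendsto (fun n => P (f n)) atTop (𝓝 0) := by
  have h := hP.tendsto_cofinite_zero.comp hf.tendsto_cofinite
  rw [Nat.cofinite_eq_atTop] at h
  have h' := h.sqrt
  rw [tendsto_zero_iff_norm_tendsto_zero]
  simpa [Function.comp_def] using h'

/-- The necessary conditions on an eigenvalue: decay on both half-lines together with the matching
condition at the origin. -/
theorem exists_matching_of_transfer {c : ℤ → CoinParams} {p o : CoinParams}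
    (hc : ∀ x, x ≠ 0 → c x = p) (hc0 : c 0 = o) {μ : ℂ} (hμ : ‖μ‖ = 1) {P Q : ℤ → ℂ}
    (hP : Summable fun x => ‖P x‖ ^ 2) (hQ : Summable fun x => ‖Q x‖ ^ 2)
    (hne : ∃ x, ¬(P x = 0 ∧ Q x = 0))
    (h : ∀ x, Transfer (c x).α (c x).β μ (P x) (Q x) (P (x + 1)) (Q (x + 1))) :
    ∃ k : ℂ, k ^ 2 = ((‖p.β‖ ^ 2 - μ.im ^ 2 : ℝ) : ℂ) ∧ ‖μ.re - k‖ < ‖p.α‖ ∧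
      μ.re * k = ((μ.im ^ 2 - (conj o.β * p.β).re : ℝ) : ℂ) := by
  have hsymm : ∀ x, Transfer (conj (c x).α) (-(c x).β) (conj μ) (P (x + 1)) (Q (x + 1))
      (P x) (Q x) := fun x => (h x).symm (c x).α_ne_zero (c x).norm_sq_add hμ
  have hstep : ∀ x, (P x = 0 ∧ Q x = 0) ↔ (P (x + 1) = 0 ∧ Q (x + 1) = 0) := fun x =>
    ⟨fun hx => (h x).eq_zero (c x).α_ne_zero hx.1 hx.2,
      fun hx => (hsymm x).eq_zero (by simpa using (c x).α_ne_zero) hx.1 hx.2⟩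
  have h0 : ¬(P 0 = 0 ∧ Q 0 = 0) := by
    intro h0
    obtain ⟨x, hx⟩ := hne
    refine hx (Int.induction_on x h0 (fun n ih => (hstep _).1 ih) fun n ih => (hstep _).2 ?_)
    rwa [sub_add_cancel]
  have h1 : ¬(P 1 = 0 ∧ Q 1 = 0) := fun h1 => h0 ((hstep 0).2 (by simpa using h1))
  obtain ⟨l, hl, hl'⟩ := exists_isTraceFreeEigen_of_tendsto (P := fun n : ℕ => P (1 + n))
    (Q := fun n : ℕ => Q (1 + n)) p.α_ne_zero p.norm_sq_add hμ
    (fun n => by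
      have := h (1 + n)
      rw [hc (1 + n) (by omega)] at this
      simpa [add_assoc] using this)
    (tendsto_zero_of_summable_norm_sq hP fun a b hab => by simpa using hab)
    (tendsto_zero_of_summable_norm_sq hQ fun a b hab => by simpa using hab)
    (by simpa using h1)
  obtain ⟨k', hk, hk'⟩ := exists_isTraceFreeEigen_of_tendsto (P := fun n : ℕ => P (-n))
    (Q := fun n : ℕ => Q (-n)) (α := conj p.α) (β := -p.β) (μ := conj μ)
    (by simpa using p.α_ne_zero) (by simpa using p.norm_sq_add) (by simpa using hμ)
    (fun n => by
      have := hsymm (-(n + 1 : ℕ))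
      rw [hc _ (by omega)] at this
      have e : -((n + 1 : ℕ) : ℤ) + 1 = -n := by push_cast; ring
      rwa [e] at this)
    (tendsto_zero_of_summable_norm_sq hP fun a b hab => by simpa using hab)
    (tendsto_zero_of_summable_norm_sq hQ fun a b hab => by simpa using hab)
    (by simpa using h0)
  simp only [Nat.cast_zero, neg_zero, add_zero, norm_conj, conj_re] at hl hk hk'
  obtain ⟨k, rfl⟩ : ∃ k, k' = -k := ⟨-k', (neg_neg _).symm⟩
  -- Inverting the transfer matrix changes the sign of its trace-free part.
  have hk0 : IsTraceFreeEigen p.β μ k (P 0) (Q 0) := by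
    obtain ⟨a, b⟩ := hk
    simp only [conj_im, map_neg, ofReal_neg] at a b
    exact ⟨by linear_combination -a, by linear_combination -b⟩
  have hk2 := hk0.sq_eq h0
  have hl2 := hl.sq_eq h1
  have hlk : l = -k := by
    refine (sq_eq_sq_iff_eq_or_eq_neg.1 (hl2.trans hk2.symm)).resolve_left ?_
    rintro rfl
    -- The two multipliers have product `|α|²`, so they cannot both be contracting.
    have e : (μ.re + l) * (μ.re + -l) = ((‖p.α‖ ^ 2 : ℝ) : ℂ) := by
      have e' : ((μ.re : ℂ) + l) * (μ.re + -l) = μ.re ^ 2 - l ^ 2 := by ring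
      rw [e', hl2]
      norm_cast
      linarith [re_sq_add_im_sq hμ, p.norm_sq_add]
    have e' := congrArg norm e
    rw [norm_mul, norm_real, Real.norm_of_nonneg (by positivity)] at e'
    have := mul_lt_mul'' hl' hk' (norm_nonneg _) (norm_nonneg _)
    rw [e', ← sq] at this
    exact lt_irrefl _ this
  rw [hlk] at hl
  have ht := h 0
  rw [hc0, zero_add] at ht
  exact ⟨k, hk2, by simpa [sub_eq_add_neg] using hk',
    (isTraceFreeEigen_neg_iff o.α_ne_zero ht hk0 h0).1 hl⟩

theorem re_conj_mul_sq_le (β β₀ : ℂ) : (conj β₀ * β).re ^ 2 ≤ ‖β₀‖ ^ 2 * ‖β‖ ^ 2 := by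
  have h := abs_re_le_norm (conj β₀ * β)
  rw [norm_mul, norm_conj] at h
  rw [← mul_pow]
  exact sq_le_sq' (abs_le.1 h).1 (abs_le.1 h).2

theorem CoinParams.norm_β_sq_lt_one (p : CoinParams) : ‖p.β‖ ^ 2 < 1 := by
  have := pow_pos (norm_pos_iff.2 p.α_ne_zero) 2
  linarith [p.norm_sq_add]

theorem CoinParams.re_sq_le (p o : CoinParams) : (conj o.β * p.β).re ^ 2 ≤ ‖p.β‖ ^ 2 :=
  (re_conj_mul_sq_le p.β o.β).trans
    (mul_le_of_le_one_left (by positivity) o.norm_β_sq_lt_one.le)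

theorem CoinParams.re_lt_one (p o : CoinParams) : (conj o.β * p.β).re < 1 := by
  have h := (p.re_sq_le o).trans_lt p.norm_β_sq_lt_one
  exact (abs_lt.1 ((sq_lt_one_iff_abs_lt_one _).1 h)).2

theorem CoinParams.re_sq_lt (p o : CoinParams) (h : (conj o.β * p.β).re < ‖p.β‖ ^ 2) :
    (conj o.β * p.β).re ^ 2 < ‖p.β‖ ^ 2 := by
  have hβ : p.β ≠ 0 := by
    intro hβ
    simp [hβ] at h
  exact (re_conj_mul_sq_le p.β o.β).trans_lt
    (mul_lt_of_lt_one_left (pow_pos (norm_pos_iff.2 hβ) 2) o.norm_β_sq_lt_one)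

theorem CoinParams.one_add_sub_pos (p o : CoinParams) :
    0 < 1 + ‖p.β‖ ^ 2 - 2 * (conj o.β * p.β).re := by
  nlinarith [p.re_sq_le o, pow_pos (sub_pos.2 (p.re_lt_one o)) 2]

/-- Eliminating `k` from the matching condition `c k = s² - r`, where `k² = |β|² - s²` and
`c² = 1 - s²`, determines `s²`; contraction fixes the sign `s² > r`, hence `|β|² > r`. -/
theorem lt_and_eq_of_matching {p o : CoinParams} {μ k : ℂ} (hμ : ‖μ‖ = 1)
    (hk : k ^ 2 = ((‖p.β‖ ^ 2 - μ.im ^ 2 : ℝ) : ℂ)) (hlt : ‖μ.re - k‖ < ‖p.α‖)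
    (hm : μ.re * k = ((μ.im ^ 2 - (conj o.β * p.β).re : ℝ) : ℂ)) :
    (conj o.β * p.β).re < ‖p.β‖ ^ 2 ∧
      μ.im ^ 2 * (1 + ‖p.β‖ ^ 2 - 2 * (conj o.β * p.β).re) =
        ‖p.β‖ ^ 2 - (conj o.β * p.β).re ^ 2 := by
  have hr1 := p.re_lt_one o
  have hw := p.one_add_sub_pos o
  have hcs := re_sq_add_im_sq hμ
  have hp := p.norm_sq_add
  generalize (conj o.β * p.β).re = r at *
  have hk2re := congrArg re hk
  have hmre := congrArg re hm
  have e : (μ.re * k) ^ 2 = μ.re ^ 2 * k ^ 2 := by ring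
  rw [hm, hk] at e
  norm_cast at e
  rw [ofReal_re, sq, mul_re] at hk2re
  rw [re_ofReal_mul, ofReal_re] at hmre
  have hn : (μ.re - k.re) ^ 2 + k.im ^ 2 < ‖p.α‖ ^ 2 := by
    have h := pow_lt_pow_left₀ hlt (norm_nonneg _) two_ne_zero
    rw [Complex.sq_norm, normSq_apply] at h
    simp only [sub_re, sub_im, ofReal_re, ofReal_im] at h
    linarith
  have hpos : r < μ.im ^ 2 := by nlinarith [sq_nonneg k.re]
  have heq : μ.im ^ 2 * (1 + ‖p.β‖ ^ 2 - 2 * r) = ‖p.β‖ ^ 2 - r ^ 2 := by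
    have : μ.re ^ 2 = 1 - μ.im ^ 2 := by linarith
    rw [this] at e
    linear_combination e
  refine ⟨?_, heq⟩
  have h3 : 0 < (‖p.β‖ ^ 2 - r) * (1 - r) := by
    have h4 := mul_pos (sub_pos.2 hpos) hw
    have h5 : (μ.im ^ 2 - r) * (1 + ‖p.β‖ ^ 2 - 2 * r) = (‖p.β‖ ^ 2 - r) * (1 - r) := by
      linear_combination heq
    rwa [h5] at h4
  exact sub_pos.1 (pos_of_mul_pos_left h3 (sub_pos.2 hr1).le)

/-- The bilateral sequence that is geometric with ratio `ρ` up to the origin, where its value is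
`a`, and geometric with ratio `σ` from `1` on, where its value is `b`. -/
noncomputable def twoSidedGeometric (ρ σ a b : ℂ) (x : ℤ) : ℂ :=
  if x ≤ 0 then ρ ^ x * a else σ ^ (x - 1) * b

theorem summable_norm_sq_twoSidedGeometric {ρ σ : ℂ} (a b : ℂ) (hρ : 1 < ‖ρ‖) (hσ : ‖σ‖ < 1) :
    Summable fun x => ‖twoSidedGeometric ρ σ a b x‖ ^ 2 := by
  have geo : ∀ t : ℂ, ‖t‖ < 1 → ∀ d : ℂ, Summable fun n : ℕ => ‖t ^ n * d‖ ^ 2 := by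
    intro t ht d
    have := (summable_geometric_of_lt_one (r := ‖t‖ ^ 2) (by positivity)
      (pow_lt_one₀ (norm_nonneg _) ht two_ne_zero)).mul_right (‖d‖ ^ 2)
    refine this.congr fun n => ?_
    rw [norm_mul, norm_pow, mul_pow, ← pow_mul, ← pow_mul, mul_comm 2 n]
  refine Summable.of_nat_of_neg ?_ ?_
  · rw [← summable_nat_add_iff 1]
    refine (geo σ hσ b).congr fun n => ?_
    rw [twoSidedGeometric, if_neg (by omega)]
    simp
  · refine (geo ρ⁻¹ (by rw [norm_inv]; exact inv_lt_one_of_one_lt₀ hρ) a).congr fun n => ?_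
    rw [twoSidedGeometric, if_pos (by omega)]
    simp

theorem IsTraceFreeEigen.smul {β μ k P Q : ℂ} (h : IsTraceFreeEigen β μ k P Q) (t : ℂ) :
    IsTraceFreeEigen β μ k (t * P) (t * Q) :=
  ⟨by linear_combination t * h.1, by linear_combination t * h.2⟩

theorem IsTraceFreeEigen.transfer {α β μ k P Q P' Q' : ℂ} (h : IsTraceFreeEigen β μ k P Q)
    (hP : α * P' = (μ.re + k) * P) (hQ : α * Q' = (μ.re + k) * Q) :
    Transfer α β μ P Q P' Q' :=
  ⟨by linear_combination hP - h.1 + P * re_add_I_mul_im μ,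
    by linear_combination hQ - h.2 + Q * re_sub_I_mul_im μ⟩

/-- Conversely, under the matching condition an eigenvector of the trace-free part at the origin
extends to a square-summable solution on the whole line. -/
theorem exists_transfer_of_matching {c : ℤ → CoinParams} {p o : CoinParams}
    (hc : ∀ x, x ≠ 0 → c x = p) (hc0 : c 0 = o) {μ : ℂ} (hβ : p.β ≠ 0)
    {k : ℝ} (hk : k ^ 2 = ‖p.β‖ ^ 2 - μ.im ^ 2) (hl : ‖p.α‖ < ‖(μ.re + k : ℂ)‖)
    (hr : ‖(μ.re - k : ℂ)‖ < ‖p.α‖) (hr0 : (μ.re - k : ℂ) ≠ 0)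
    (hm : μ.re * k = μ.im ^ 2 - (conj o.β * p.β).re) :
    ∃ P Q : ℤ → ℂ, (Summable fun x => ‖P x‖ ^ 2) ∧ (Summable fun x => ‖Q x‖ ^ 2) ∧
        (∃ x, ¬(P x = 0 ∧ Q x = 0)) ∧
        ∀ x, Transfer (c x).α (c x).β μ (P x) (Q x) (P (x + 1)) (Q (x + 1)) := by
  have hα := p.α_ne_zero
  have hαn := norm_pos_iff.2 hα
  have hl0 : (μ.re + k : ℂ) ≠ 0 := norm_pos_iff.1 (hαn.trans hl)
  obtain ⟨Q₀, hQ₀⟩ : ∃ Q₀ : ℂ, Q₀ = I * μ.im - k := ⟨_, rfl⟩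
  have he0 : IsTraceFreeEigen p.β μ k p.β Q₀ := by
    have hb : p.β * conj p.β = (‖p.β‖ : ℂ) ^ 2 := mul_conj' p.β
    have hk' : (k : ℂ) ^ 2 = (‖p.β‖ : ℂ) ^ 2 - (μ.im : ℂ) ^ 2 := by exact_mod_cast hk
    constructor
    · rw [hQ₀]; ring
    · rw [hQ₀]; linear_combination -hb + hk' - (μ.im : ℂ) ^ 2 * I_sq
  obtain ⟨P₁, Q₁, ht⟩ : ∃ P₁ Q₁, Transfer o.α o.β μ p.β Q₀ P₁ Q₁ :=
    ⟨(μ * p.β - o.β * Q₀) / o.α, (-conj o.β * p.β + conj μ * Q₀) / o.α,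
      mul_div_cancel₀ _ o.α_ne_zero, mul_div_cancel₀ _ o.α_ne_zero⟩
  have he1 : IsTraceFreeEigen p.β μ (-k) P₁ Q₁ :=
    (isTraceFreeEigen_neg_iff o.α_ne_zero ht he0 fun h => hβ h.1).2 (by exact_mod_cast hm)
  obtain ⟨ρ, hρ⟩ : ∃ ρ, p.α * ρ = μ.re + k := ⟨_, mul_div_cancel₀ _ hα⟩
  obtain ⟨σ, hσ⟩ : ∃ σ, p.α * σ = μ.re - k := ⟨_, mul_div_cancel₀ _ hα⟩
  have hρ0 : ρ ≠ 0 := right_ne_zero_of_mul (hρ ▸ hl0)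
  have hσ0 : σ ≠ 0 := right_ne_zero_of_mul (hσ ▸ hr0)
  have hρ1 : 1 < ‖ρ‖ := by
    rw [← hρ, norm_mul] at hl
    exact (lt_mul_iff_one_lt_right hαn).1 hl
  have hσ1 : ‖σ‖ < 1 := by
    rw [← hσ, norm_mul] at hr
    exact (mul_lt_iff_lt_one_right hαn).1 hr
  refine ⟨twoSidedGeometric ρ σ p.β P₁, twoSidedGeometric ρ σ Q₀ Q₁,
    summable_norm_sq_twoSidedGeometric _ _ hρ1 hσ1,
    summable_norm_sq_twoSidedGeometric _ _ hρ1 hσ1, ⟨0, fun h => hβ ?_⟩, fun x => ?_⟩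
  · simpa [twoSidedGeometric] using h.1
  · rcases lt_trichotomy x 0 with hx | rfl | hx
    · rw [hc x hx.ne]
      simp only [twoSidedGeometric, if_pos hx.le, if_pos (show x + 1 ≤ 0 by omega),
        zpow_add_one₀ hρ0]
      exact (he0.smul _).transfer (by linear_combination ρ ^ x * p.β * hρ)
        (by linear_combination ρ ^ x * Q₀ * hρ)
    · rw [hc0]
      simpa [twoSidedGeometric] using ht
    · rw [hc x hx.ne']
      obtain ⟨y, rfl⟩ : ∃ y, x = y + 1 := ⟨x - 1, by ring⟩
      simp only [twoSidedGeometric, if_neg (show ¬(y + 1 ≤ 0) by omega),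
        if_neg (show ¬(y + 1 + 1 ≤ 0) by omega), add_sub_cancel_right, zpow_add_one₀ hσ0]
      exact (he1.smul _).transfer (by linear_combination σ ^ y * P₁ * hσ)
        (by linear_combination σ ^ y * Q₁ * hσ)

theorem mem_pointSpectrum_iff_im_sq {c : ℤ → CoinParams} {p o : CoinParams}
    (hc : ∀ x, x ≠ 0 → c x = p) (hc0 : c 0 = o) (hΔ : o.Δ = p.Δ) {μ : ℂ} (hμ : ‖μ‖ = 1) :
    exp (I * p.Δ) * μ ∈ pointSpectrum (timeEvolution c) ↔
      (conj o.β * p.β).re < ‖p.β‖ ^ 2 ∧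
        μ.im ^ 2 * (1 + ‖p.β‖ ^ 2 - 2 * (conj o.β * p.β).re) =
          ‖p.β‖ ^ 2 - (conj o.β * p.β).re ^ 2 := by
  have hΔ' : ∀ x, (c x).Δ = p.Δ := by
    intro x
    rcases eq_or_ne x 0 with rfl | hx
    · rw [hc0, hΔ]
    · rw [hc x hx]
  rw [mem_pointSpectrum_iff_transfer c hΔ' hμ]
  constructor
  · rintro ⟨P, Q, hP, hQ, hne, h⟩
    obtain ⟨k, hk, hlt, hm⟩ := exists_matching_of_transfer hc hc0 hμ hP hQ hne h
    exact lt_and_eq_of_matching hμ hk hlt hm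
  · rintro ⟨hlt, heq⟩
    have hβ : p.β ≠ 0 := by
      intro hβ
      simp [hβ] at hlt
    have hr1 := p.re_lt_one o
    have hw := p.one_add_sub_pos o
    have hcs := re_sq_add_im_sq hμ
    have hp := p.norm_sq_add
    have hα := pow_pos (norm_pos_iff.2 p.α_ne_zero) 2
    obtain ⟨r, hr⟩ : ∃ r, r = (conj o.β * p.β).re := ⟨_, rfl⟩
    rw [← hr] at hlt heq hr1 hw
    have hpos : 0 < μ.im ^ 2 - r := by
      have h4 := mul_pos (sub_pos.2 hlt) (sub_pos.2 hr1)
      have h5 : (‖p.β‖ ^ 2 - r) * (1 - r) = (μ.im ^ 2 - r) * (1 + ‖p.β‖ ^ 2 - 2 * r) := by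
        linear_combination -heq
      rw [h5] at h4
      exact pos_of_mul_pos_left h4 hw.le
    have hre : μ.re ≠ 0 := by
      intro h0
      have h1 : μ.im ^ 2 = 1 := by rw [h0] at hcs; linarith
      rw [h1] at heq
      nlinarith [pow_pos (sub_pos.2 hr1) 2]
    obtain ⟨k, hk⟩ : ∃ k : ℝ, μ.re * k = μ.im ^ 2 - r := ⟨_, mul_div_cancel₀ _ hre⟩
    have hk2 : k ^ 2 = ‖p.β‖ ^ 2 - μ.im ^ 2 := by
      apply mul_left_cancel₀ (pow_ne_zero 2 hre)
      have h6 : μ.re ^ 2 = 1 - μ.im ^ 2 := by linarith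
      have h7 : μ.re ^ 2 * k ^ 2 = (μ.im ^ 2 - r) ^ 2 := by rw [← hk]; ring
      rw [h7, h6]
      linear_combination heq
    have hprod : (μ.re + k) * (μ.re - k) = ‖p.α‖ ^ 2 := by linear_combination hcs + -hk2 - hp
    have hck : 0 < μ.re * k := hk ▸ hpos
    refine exists_transfer_of_matching hc hc0 hβ hk2 ?_ ?_ ?_ (hr ▸ hk)
    · rw [← ofReal_add, norm_real, Real.norm_eq_abs, ← abs_of_nonneg (norm_nonneg p.α)]
      refine sq_lt_sq.1 ?_
      nlinarith [sq_nonneg k]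
    · rw [← ofReal_sub, norm_real, Real.norm_eq_abs, ← abs_of_nonneg (norm_nonneg p.α)]
      refine sq_lt_sq.1 ?_
      have hk0 : 0 < k ^ 2 := pow_pos (abs_pos.2 (right_ne_zero_of_mul hck.ne')) 2 |>.trans_eq
        (sq_abs k)
      have hkc : k ^ 2 < μ.re * k := by
        refine lt_of_pow_lt_pow_left₀ 2 hck.le ?_
        have h8 : (μ.re * k) ^ 2 - (k ^ 2) ^ 2 = k ^ 2 * ((μ.re + k) * (μ.re - k)) := by ring
        rw [hprod] at h8
        linarith [mul_pos hk0 hα]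
      linarith
    · rw [← ofReal_sub]
      norm_cast
      exact right_ne_zero_of_mul (hprod ▸ hα.ne')

/-- The eigenvalues in closed form: with `a = (1 - r) / √(1 + |β|² - 2 r)` and
`d = √(|β|² - r²) / √(1 + |β|² - 2 r)`, they are the four points `e^{iΔ} (± a ± i d)`. -/
theorem mem_pointSpectrum_iff_eq {c : ℤ → CoinParams} {p o : CoinParams}
    (hc : ∀ x, x ≠ 0 → c x = p) (hc0 : c 0 = o) (hΔ : o.Δ = p.Δ) {a d : ℝ}
    (hlt : (conj o.β * p.β).re < ‖p.β‖ ^ 2) (had : a ^ 2 + d ^ 2 = 1)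
    (hd : d ^ 2 * (1 + ‖p.β‖ ^ 2 - 2 * (conj o.β * p.β).re) =
      ‖p.β‖ ^ 2 - (conj o.β * p.β).re ^ 2) (z : ℂ) :
    z ∈ pointSpectrum (timeEvolution c) ↔
      z = (-a + I * d) * exp (I * p.Δ) ∨ z = -((-a + I * d) * exp (I * p.Δ)) ∨
        z = (-a - I * d) * exp (I * p.Δ) ∨ z = -((-a - I * d) * exp (I * p.Δ)) := by
  have hw := p.one_add_sub_pos o
  have he : exp (I * p.Δ) ≠ 0 := exp_ne_zero _
  have hen : ‖exp (I * p.Δ)‖ = 1 := by rw [mul_comm]; exact norm_exp_ofReal_mul_I _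
  obtain ⟨μ, rfl⟩ : ∃ μ, z = exp (I * p.Δ) * μ := ⟨_, (mul_div_cancel₀ z he).symm⟩
  have hpt : ∀ ν : ℂ, exp (I * p.Δ) * μ = ν * exp (I * p.Δ) ↔ μ = ν := fun ν => by
    rw [mul_comm, mul_left_inj' he]
  have hiff : exp (I * p.Δ) * μ ∈ pointSpectrum (timeEvolution c) ↔
      μ.re ^ 2 = a ^ 2 ∧ μ.im ^ 2 = d ^ 2 := by
    constructor
    · intro h
      have hμ := norm_eq_one_of_mem_pointSpectrum h
      rw [norm_mul, hen, one_mul] at hμ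
      have h1 := ((mem_pointSpectrum_iff_im_sq hc hc0 hΔ hμ).1 h).2
      have h2 : μ.im ^ 2 = d ^ 2 := mul_right_cancel₀ hw.ne' (h1.trans hd.symm)
      exact ⟨by linarith [re_sq_add_im_sq hμ], h2⟩
    · rintro ⟨h1, h2⟩
      have hμ : ‖μ‖ = 1 := by
        have h3 : ‖μ‖ ^ 2 = 1 := by
          rw [Complex.sq_norm, normSq_apply]
          linarith
        exact (pow_eq_one_iff_of_nonneg (norm_nonneg _) two_ne_zero).1 h3
      exact (mem_pointSpectrum_iff_im_sq hc hc0 hΔ hμ).2 ⟨hlt, h2 ▸ hd⟩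
  rw [hiff, ← neg_mul, ← neg_mul, hpt, hpt, hpt, hpt, sq_eq_sq_iff_eq_or_eq_neg,
    sq_eq_sq_iff_eq_or_eq_neg]
  simp only [Complex.ext_iff, add_re, sub_re, neg_re, ofReal_re, I_re, mul_re, I_im, ofReal_im,
    add_im, sub_im, neg_im, mul_im]
  simp only [zero_mul, mul_zero, one_mul, sub_zero, add_zero, zero_add, neg_zero, zero_sub,
    neg_neg]
  tauto

theorem ncard_pair_neg_pair {z w : ℂ} (hz : z ≠ 0) (hw : w ≠ 0) (h : z ≠ w) (h' : z ≠ -w) :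
    ({z, -z, w, -w} : Set ℂ).ncard = 4 := by
  have hz' : z ≠ -z := fun e => hz (self_eq_neg.1 e)
  have hw' : w ≠ -w := fun e => hw (self_eq_neg.1 e)
  have h1 : -z ≠ w := fun e => h' (neg_eq_iff_eq_neg.1 e)
  rw [Set.ncard_insert_of_notMem (by simp [hz', h, h']),
    Set.ncard_insert_of_notMem (by simp [h1, h]), Set.ncard_pair hw']

end QuantumWalk

theorem mainTheorem2 (m o p : QuantumWalk.CoinParams) (α β : ℂ) (Δ : ℝ)
    (hp : p.α = α ∧ p.β = β ∧ p.Δ = Δ) (hm : m.α = α ∧ m.β = β ∧ m.Δ = Δ) (ho : o.Δ = Δ) :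
    let σp : Set ℂ := QuantumWalk.pointSpectrum
      (QuantumWalk.timeEvolution (QuantumWalk.twoPhaseOneDefect m o p))
    let r : ℝ := (conj o.β * β).re
    let z₁ : ℂ := ((r - 1 : ℝ) + Complex.I * (√(‖β‖ ^ 2 - r ^ 2) : ℝ)) /
      (√(1 + ‖β‖ ^ 2 - 2 * r) : ℝ) * Complex.exp (Complex.I * Δ)
    let z₃ : ℂ := ((r - 1 : ℝ) - Complex.I * (√(‖β‖ ^ 2 - r ^ 2) : ℝ)) /
      (√(1 + ‖β‖ ^ 2 - 2 * r) : ℝ) * Complex.exp (Complex.I * Δ)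
    (σp.Nonempty ↔ ‖β‖ ^ 2 > (β * conj o.β).re) ∧
      (‖β‖ ^ 2 > (β * conj o.β).re → σp = {z₁, -z₁, z₃, -z₃} ∧ σp.ncard = 4) := by
  intro σp r z₁ z₃
  obtain ⟨rfl, rfl, rfl⟩ := hp
  -- Equal parameters on both half-lines make the two coins equal.
  have hmp : m = p := by
    cases m; cases p; simp_all
  subst hmp
  set c := QuantumWalk.twoPhaseOneDefect m o m with hcdef
  have hc : ∀ x, x ≠ 0 → c x = m := fun x hx => by
    simp [hcdef, QuantumWalk.twoPhaseOneDefect, hx]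
  have hc0 : c 0 = o := by simp [hcdef, QuantumWalk.twoPhaseOneDefect]
  have hr : (m.β * conj o.β).re = r := by rw [mul_comm]
  rw [hr]
  have hw : 0 < 1 + ‖m.β‖ ^ 2 - 2 * r := m.one_add_sub_pos o
  have hr1 : r < 1 := m.re_lt_one o
  have hsw : 0 < √(1 + ‖m.β‖ ^ 2 - 2 * r) := Real.sqrt_pos.2 hw
  have hmain : ‖m.β‖ ^ 2 > r → σp = {z₁, -z₁, z₃, -z₃} ∧ σp.ncard = 4 := by
    intro hlt
    have ht : 0 < ‖m.β‖ ^ 2 - r ^ 2 := sub_pos.2 (m.re_sq_lt o hlt)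
    have hst : 0 < √(‖m.β‖ ^ 2 - r ^ 2) := Real.sqrt_pos.2 ht
    obtain ⟨a, ha⟩ : ∃ a, a = (1 - r) / √(1 + ‖m.β‖ ^ 2 - 2 * r) := ⟨_, rfl⟩
    obtain ⟨d, hd⟩ : ∃ d, d = √(‖m.β‖ ^ 2 - r ^ 2) / √(1 + ‖m.β‖ ^ 2 - 2 * r) := ⟨_, rfl⟩
    have ha0 : 0 < a := ha ▸ div_pos (sub_pos.2 hr1) hsw
    have hd0 : 0 < d := hd ▸ div_pos hst hsw
    have hd2 : d ^ 2 * (1 + ‖m.β‖ ^ 2 - 2 * r) = ‖m.β‖ ^ 2 - r ^ 2 := by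
      rw [hd, div_pow, Real.sq_sqrt ht.le, Real.sq_sqrt hw.le, div_mul_cancel₀ _ hw.ne']
    have had : a ^ 2 + d ^ 2 = 1 := by
      rw [ha, hd, div_pow, div_pow, Real.sq_sqrt ht.le, Real.sq_sqrt hw.le]
      rw [← add_div, div_eq_one_iff_eq hw.ne']
      ring
    have hz₁ : z₁ = (-a + I * d) * exp (I * m.Δ) := by
      simp only [z₁, ha, hd]
      push_cast
      ring
    have hz₃ : z₃ = (-a - I * d) * exp (I * m.Δ) := by
      simp only [z₃, ha, hd]
      push_cast
      ring
    have hset : σp = {z₁, -z₁, z₃, -z₃} := by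
      ext z
      rw [hz₁, hz₃]
      exact QuantumWalk.mem_pointSpectrum_iff_eq hc hc0 ho hlt had hd2 z
    refine ⟨hset, ?_⟩
    rw [hset, hz₁, hz₃]
    have he : exp (I * m.Δ) ≠ 0 := exp_ne_zero _
    apply QuantumWalk.ncard_pair_neg_pair
    · refine mul_ne_zero (fun h => ?_) he
      simpa [ha0.ne'] using congrArg re h
    · refine mul_ne_zero (fun h => ?_) he
      simpa [ha0.ne'] using congrArg re h
    · rw [Ne, mul_left_inj' he]
      intro h
      have := congrArg im h
      simp at this
      linarith
    · rw [← neg_mul, Ne, mul_left_inj' he]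
      intro h
      have := congrArg re h
      simp at this
      linarith
  refine ⟨⟨?_, fun h => ⟨z₁, ?_⟩⟩, hmain⟩
  · rintro ⟨z, hz⟩
    have he : exp (I * m.Δ) ≠ 0 := exp_ne_zero _
    have hen : ‖exp (I * m.Δ)‖ = 1 := by rw [mul_comm]; exact norm_exp_ofReal_mul_I _
    have hzn := QuantumWalk.norm_eq_one_of_mem_pointSpectrum hz
    obtain ⟨μ, rfl⟩ : ∃ μ, z = exp (I * m.Δ) * μ := ⟨_, (mul_div_cancel₀ z he).symm⟩
    rw [norm_mul, hen, one_mul] at hzn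
    exact ((QuantumWalk.mem_pointSpectrum_iff_im_sq hc hc0 ho hzn).1 hz).1
  · rw [(hmain h).1]
    exact Set.mem_insert _ _
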